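/- Let $1\le k<n$ be integers and $s\in(1/2,1)$. Write points of $\mathbb{R}^n=\mathbb{R}^k\times\mathbb{R}^{n-k}$ as $(y,z)$, and let $\mathcal{H}^k$ be Lebesgue measure on $\mathbb{R}^k$ and $\omega_k=\mathcal{H}^k(B_1)$. Let $\mathcal{K}_k^s$ be the set of measurable $K:\mathbb{R}^n\to[0,\infty)$ such that for all $z\in\mathbb{R}^{n-k}$ and $r>0$ $$\mathcal{H}^k\big(\{y\in\mathbb{R}^k: K(y,z)>r^{-n-2s}\}\big)=\begin{cases}\mathcal{H}^k\big(B_{(r^2-|z|^2)^{1/2}}\big)&\text{if }|z|<r,\\ 0&\text{if }|z|\ge r,\end{cases}$$ where $B_\rho$ is the ball of radius $\rho$ in $\mathbb{R}^k$ centered at $0$. Let $u:\mathbb{R}^n\to\mathbb{R}$ be continuous and $x_0\in\mathbb{R}^n$. Suppose that $u$ is $C^{1,1}$ at $x_0$, i.e. there are $p\in\mathbb{R}^n$ and $\rho,C>0$ with $|u(x_0+x)-u(x_0)-x\cdot p|\le C|x|^2$ for $|x|<\rho$; that $\int_{\mathbb{R}^n}|u(x)|(1+|x|)^{-n-2s}\,dx<\infty$;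 and that $$\tilde u(x)=u(x_0+x)-u(x_0)-x\cdot\nabla u(x_0)\ge 0\quad\text{for all }x\in\mathbb{R}^n.$$ Put $$\mathcal{F}_k^su(x_0)=c_{n,s}\inf_{K\in\mathcal{K}_k^s}\int_{\mathbb{R}^n}\tilde u(x)K(x)\,dx,\qquad c_{n,s}=\frac{4^s\,\Gamma(n/2+s)}{\pi^{n/2}|\Gamma(-s)|},$$ the integrals being taken in $[0,\infty]$. Assume that $\mathcal{H}^k(\{y\in\mathbb{R}^k:\tilde u(y,z)\le\lambda\})<\infty$ for all $\lambda>0$ and all $z\in\mathbb{R}^{n-k}$. Then $\mathcal{F}_k^su(x_0)<\infty$, and there is, for each $z\in\mathbb{R}^{n-k}$, a measure-preserving map $\sigma_z:\mathbb{R}^k\to[0,\infty)$ (with respect to Lebesgue measure on both sides), with $(z,y)\mapsto\sigma_z(y)$ measurable, such that $$\mathcal{F}_k^su(x_0)=c_{n,s}\int_{\mathbb{R}^{n-k}}\int_{\mathbb{R}^k}\frac{\tilde u(y,z)}{\big((\omega_k^{-1}\sigma_z(y))^{2/k}+|z|^2\big)^{\frac{n+2s}{2}}}\,dy\,dz.$$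 In particular the infimum is attained: the kernel $K(y,z)=\big((\omega_k^{-1}\sigma_z(y))^{2/k}+|z|^2\big)^{-\frac{n+2s}{2}}$ (with value $0$ where the base vanishes) belongs to $\mathcal{K}_k^s$ and $\int_{\mathbb{R}^n}\tilde u K\,dx=\inf_{K'\in\mathcal{K}_k^s}\int_{\mathbb{R}^n}\tilde u K'\,dx$. -/

import Mathlib

open MeasureTheory
open scoped ENNReal

/-- The point `(y, z)` of `ℝⁿ = ℝᵏ × ℝⁿ⁻ᵏ`, for `k ≤ n`: the first `k` coordinates are those of `y`,
the last `n - k` coordinates are those of `z`. -/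
noncomputable def joinPoint {n k : ℕ} (y : EuclideanSpace ℝ (Fin k))
    (z : EuclideanSpace ℝ (Fin (n - k))) : EuclideanSpace ℝ (Fin n) :=
  WithLp.toLp 2 fun i =>
    if h : (i : ℕ) < k then y ⟨i, h⟩ else z ⟨(i : ℕ) - k, by have := i.isLt; omega⟩

/-- `ω_k`, the `k`-dimensional volume of the unit ball of `ℝᵏ`. -/
noncomputable def unitBallVolume (k : ℕ) : ℝ :=
  (volume (Metric.ball (0 : EuclideanSpace ℝ (Fin k)) 1)).toReal

/-- The normalizing constant `c_{n,s}` of the fractional Laplacian `Δˢ` on `ℝⁿ`, `0 < s < 1`. -/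
noncomputable def fracLaplacianConst (n : ℕ) (s : ℝ) : ℝ :=
  (4 : ℝ) ^ s * Real.Gamma ((n : ℝ) / 2 + s) /
    (Real.pi ^ ((n : ℝ) / 2) * |Real.Gamma (-s)|)

/-- The family `𝒦_k^s` of admissible kernels on `ℝⁿ`: nonnegative measurable `K` such that for every
`z` and every `r > 0` the slice `{y : K (y, z) > r ^ (-n-2s)}` has the `k`-dimensional volume of the
slice at height `z` of the ball of radius `r` of `ℝⁿ`. -/
def admissibleKernels (n k : ℕ) (s : ℝ) : Set (EuclideanSpace ℝ (Fin n) → ℝ) :=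
  {K | Measurable K ∧ (∀ x, 0 ≤ K x) ∧
    ∀ (z : EuclideanSpace ℝ (Fin (n - k))) (r : ℝ), 0 < r →
      volume {y : EuclideanSpace ℝ (Fin k) | r ^ (-(n : ℝ) - 2 * s) < K (joinPoint y z)} =
        if ‖z‖ < r then
          volume (Metric.ball (0 : EuclideanSpace ℝ (Fin k)) (Real.sqrt (r ^ 2 - ‖z‖ ^ 2)))
        else 0}

/-- `u` is `C^{1,1}` at the point `x₀`. -/
def IsC11At {n : ℕ} (u : EuclideanSpace ℝ (Fin n) → ℝ) (x₀ : EuclideanSpace ℝ (Fin n)) : Prop :=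
  ∃ (p : EuclideanSpace ℝ (Fin n)) (ρ C : ℝ), 0 < ρ ∧ 0 < C ∧
    ∀ x ∈ Metric.ball (0 : EuclideanSpace ℝ (Fin n)) ρ,
      |u (x₀ + x) - u x₀ - inner ℝ x p| ≤ C * ‖x‖ ^ 2

/-- `ũ(x) = u(x₀ + x) - u(x₀) - x · ∇u(x₀)`. -/
noncomputable def linearizedIncrement {n : ℕ} (u : EuclideanSpace ℝ (Fin n) → ℝ)
    (x₀ x : EuclideanSpace ℝ (Fin n)) : ℝ :=
  u (x₀ + x) - u x₀ - inner ℝ x (gradient u x₀)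

/-- `L_K u(x₀) = ∫ ũ(x) K(x) dx` as an element of `[0, ∞]`, for functions `u` with `ũ ≥ 0` and kernels
`K ≥ 0` (the integral is infinite for some admissible kernels). -/
noncomputable def kernelOperator {n : ℕ} (K u : EuclideanSpace ℝ (Fin n) → ℝ)
    (x₀ : EuclideanSpace ℝ (Fin n)) : ℝ≥0∞ :=
  ∫⁻ x, ENNReal.ofReal (linearizedIncrement u x₀ x * K x)

/-- `ℱ_k^s u(x₀) = c_{n,s} inf_{K ∈ 𝒦_k^s} ∫ ũ(x) K(x) dx` as an element of `[0, ∞]`, for functions `u`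
with `ũ ≥ 0`. -/
noncomputable def nonlocalF {n : ℕ} (k : ℕ) (s : ℝ) (u : EuclideanSpace ℝ (Fin n) → ℝ)
    (x₀ : EuclideanSpace ℝ (Fin n)) : ℝ≥0∞ :=
  ENNReal.ofReal (fracLaplacianConst n s) * ⨅ K ∈ admissibleKernels n k s, kernelOperator K u x₀

/-! The levels $r^{-n-2s}$ exhaust $(0,\infty)$, so admissibility prescribes the distribution
function of $K(\cdot,z)$ on every slice: admissible kernels are equimeasurable slice by slice.
Minimizing $\int\tilde u K$ is then a bathtub problem in $y$ for each $z$, solved by any admissible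
kernel that is larger where $\tilde u(\cdot,z)$ is smaller (`lintegral_mul_le_of_equimeasurable`).

Such a kernel comes from ranking the points of a slice: $\sigma_z(y)$ is the measure of the points
preceding $y$ when ordered by $\tilde u(\cdot,z)$. Plateaus of $\tilde u$ would give this rank
atoms, so ties are broken by $|y|$, whose level sets are null. The lexicographic rank then satisfies
$|\{\sigma_z<t\}|=t$ (`measure_lexRank_lt`), which yields both measure preservation and
admissibility.

The infimum is finite because the radial kernel $|x|^{-n-2s}$ is itself admissible and integrates
$\tilde u$. -/

section Quantile

/-! ### Quantiles of a nonnegative function with sublevel sets of finite measure. -/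

variable {α : Type*} [MeasurableSpace α]

/-- The quantile is the infimum of the levels whose closed sublevel set has measure at least `t`.
Continuity from below handles the strict sublevel set; continuity from above, where `hfin` is
needed, handles the closed one. -/
theorem exists_measure_lt_le_le_measure_le (ν : Measure α) {h : α → ℝ} (hm : Measurable h)
    (h0 : ∀ x, 0 ≤ h x) (hfin : ∀ a, ν {x | h x ≤ a} < ⊤) {t : ℝ≥0∞} (ht : 0 < t) {a₀ : ℝ}
    (ha₀ : t ≤ ν {x | h x ≤ a₀}) :
    ∃ l : ℝ, ν {x | h x < l} ≤ t ∧ t ≤ ν {x | h x ≤ l} := by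
  set A : Set ℝ := {a | t ≤ ν {x | h x ≤ a}} with hA
  have hbdd : BddBelow A := by
    refine ⟨0, fun a ha => ?_⟩
    by_contra! hlt
    have : {x | h x ≤ a} = ∅ := by
      ext x; simp only [Set.mem_ofPred_eq, Set.mem_empty_iff_false, iff_false, not_le]
      exact hlt.trans_le (h0 x)
    simp only [hA, Set.mem_ofPred_eq, this, measure_empty, nonpos_iff_eq_zero] at ha
    exact ht.ne' ha
  have hne : A.Nonempty := ⟨a₀, ha₀⟩
  have hlim : Filter.Tendsto (fun m : ℕ => (1 : ℝ) / (m + 1)) Filter.atTop (nhds 0) :=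
    tendsto_one_div_add_atTop_nhds_zero_nat
  refine ⟨sInf A, ?_, ?_⟩
  · have hU : {x | h x < sInf A} = ⋃ m : ℕ, {x | h x ≤ sInf A - 1 / ((m : ℝ) + 1)} := by
      ext x
      simp only [Set.mem_ofPred_eq, Set.mem_iUnion]
      constructor
      · intro hx
        obtain ⟨m, hm⟩ := exists_nat_one_div_lt (sub_pos.2 hx)
        exact ⟨m, by linarith⟩
      · rintro ⟨m, hm⟩
        have : (0 : ℝ) < 1 / ((m : ℝ) + 1) := by positivity
        linarith
    have hmono : Monotone fun m : ℕ => {x | h x ≤ sInf A - 1 / ((m : ℝ) + 1)} := by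
      intro i j hij x hx
      simp only [Set.mem_ofPred_eq] at hx ⊢
      have : (1 : ℝ) / ((j : ℝ) + 1) ≤ 1 / ((i : ℝ) + 1) := by gcongr
      linarith
    rw [hU, hmono.measure_iUnion]
    refine iSup_le fun m => ?_
    by_contra! hlt
    have : sInf A ≤ sInf A - 1 / ((m : ℝ) + 1) := csInf_le hbdd hlt.le
    have h2 : (0 : ℝ) < 1 / ((m : ℝ) + 1) := by positivity
    linarith
  · have hI : {x | h x ≤ sInf A} = ⋂ m : ℕ, {x | h x ≤ sInf A + 1 / ((m : ℝ) + 1)} := by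
      ext x
      simp only [Set.mem_ofPred_eq, Set.mem_iInter]
      constructor
      · intro hx m
        have : (0 : ℝ) < 1 / ((m : ℝ) + 1) := by positivity
        linarith
      · intro hx
        by_contra! hlt
        obtain ⟨m, hm⟩ := exists_nat_one_div_lt (sub_pos.2 hlt)
        linarith [hx m]
    have hanti : Antitone fun m : ℕ => {x | h x ≤ sInf A + 1 / ((m : ℝ) + 1)} := by
      intro i j hij x hx
      simp only [Set.mem_ofPred_eq] at hx ⊢
      have : (1 : ℝ) / ((j : ℝ) + 1) ≤ 1 / ((i : ℝ) + 1) := by gcongr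
      linarith
    rw [hI]
    refine ge_of_tendsto' (tendsto_measure_iInter_atTop
      (fun m => (measurableSet_le hm measurable_const).nullMeasurableSet) hanti
      ⟨0, (hfin _).ne⟩) fun m => ?_
    have hlt : sInf A < sInf A + 1 / ((m : ℝ) + 1) := by
      have : (0 : ℝ) < 1 / ((m : ℝ) + 1) := by positivity
      linarith
    obtain ⟨a, haA, hal⟩ := exists_lt_of_csInf_lt hne hlt
    exact le_trans haA (measure_mono fun x hx => le_trans hx hal.le)

theorem exists_le_measure_le_of_lt_measure_univ (ν : Measure α) (h : α → ℝ) {t : ℝ≥0∞}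
    (ht : t < ν Set.univ) : ∃ a : ℝ, t ≤ ν {x | h x ≤ a} := by
  have hU : (Set.univ : Set α) = ⋃ m : ℕ, {x | h x ≤ m} := by
    ext x
    simpa using exists_nat_ge (h x)
  have hmono : Monotone fun m : ℕ => {x | h x ≤ m} := by
    intro i j hij x hx
    exact le_trans (Set.mem_ofPred.1 hx) (by exact_mod_cast hij)
  rw [hU, hmono.measure_iUnion, lt_iSup_iff] at ht
  obtain ⟨m, hm⟩ := ht
  exact ⟨m, hm.le⟩

end Quantile

/-! ### Lexicographic rank as a measure-preserving rearrangement. -/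

section LexRank

variable {α : Type*}

/-- The strict initial segment of `y` for the lexicographic order defined by `f`, then `g`. -/
def lexBelow (f g : α → ℝ) (y : α) : Set α := {x | f x < f y ∨ (f x = f y ∧ g x < g y)}

/-- The measure of the strict lexicographic initial segment of `y`. -/
noncomputable def lexRank [MeasurableSpace α] (μ : Measure α) (f g : α → ℝ) (y : α) : ℝ :=
  μ.real (lexBelow f g y)

variable [MeasurableSpace α] {μ : Measure α} {f g : α → ℝ}

theorem measure_lexBelow_lt_top (hfin : ∀ a, μ {x | f x ≤ a} < ⊤) (y : α) :
    μ (lexBelow f g y) < ⊤ := by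
  refine lt_of_le_of_lt (measure_mono fun x hx => ?_) (hfin (f y))
  rcases hx with hx | hx
  · exact hx.le
  · exact hx.1.le

/-- If `f y < f x`, the initial segment of `y` lies in that of `x`. This supplies the monotonicity
that the bathtub principle needs. -/
theorem le_of_lexRank_lt (hfin : ∀ a, μ {x | f x ≤ a} < ⊤) {x y : α}
    (h : lexRank μ f g x < lexRank μ f g y) : f x ≤ f y := by
  by_contra! hlt
  refine h.not_ge (measureReal_mono (fun w hw => ?_) (measure_lexBelow_lt_top hfin x).ne)
  rcases hw with hw | hw
  · exact Or.inl (hw.trans hlt)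
  · exact Or.inl (hw.1.trans_lt hlt)

/-- Every value is the measure of some lexicographic initial segment. -/
theorem exists_initial_segment (hf : Measurable f) (hg : Measurable g) (hf0 : ∀ x, 0 ≤ f x)
    (hg0 : ∀ x, 0 ≤ g x) (hfin : ∀ a, μ {x | f x ≤ a} < ⊤) (huniv : μ Set.univ = ⊤)
    (hgnull : ∀ c, μ {x | g x = c} = 0) {t : ℝ≥0∞} (ht : 0 < t) (ht' : t < ⊤) :
    ∃ S : Set α, μ S = t ∧ (∀ y ∈ S, lexBelow f g y ⊆ S) ∧ ∀ y ∉ S, S ⊆ lexBelow f g y := by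
  obtain ⟨a₀, ha₀⟩ := exists_le_measure_le_of_lt_measure_univ μ f (huniv ▸ ht')
  obtain ⟨l, hl₁, hl₂⟩ := exists_measure_lt_le_le_measure_le μ hf hf0 hfin ht ha₀
  -- Unless `t` is an endpoint of the jump of the distribution of `f` at `l`, the segment must cut
  -- through the plateau `{f = l}`.
  rcases hl₁.eq_or_lt with h1 | h1
  · refine ⟨{x | f x < l}, h1, fun y hy x hx => ?_, fun y hy x hx => ?_⟩
    · rcases hx with hx | hx
      · exact hx.trans hy
      · exact hx.1.trans_lt hy
    · exact Or.inl (lt_of_lt_of_le hx (not_lt.1 hy))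
  rcases hl₂.eq_or_lt with h2 | h2
  · refine ⟨{x | f x ≤ l}, h2.symm, fun y hy x hx => ?_, fun y hy x hx => ?_⟩
    · rcases hx with hx | hx
      · exact hx.le.trans hy
      · exact hx.1.le.trans hy
    · exact Or.inl (lt_of_le_of_lt hx (not_le.1 hy))
  have mlt : MeasurableSet {x | f x < l} := measurableSet_lt hf measurable_const
  have meq : MeasurableSet {x | f x = l} := measurableSet_eq_fun hf measurable_const
  have split : ∀ B : Set α, MeasurableSet B →
      μ ({x | f x < l} ∪ (B ∩ {x | f x = l})) = μ {x | f x < l} + μ.restrict {x | f x = l} B := by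
    intro B hB
    rw [Measure.restrict_apply hB, measure_union _ (hB.inter meq)]
    rw [Set.disjoint_left]
    rintro x hx ⟨-, hx'⟩
    exact (ne_of_lt hx) hx'
  have hle : μ {x | f x ≤ l} = μ {x | f x < l} + μ.restrict {x | f x = l} Set.univ := by
    rw [← split _ MeasurableSet.univ]
    congr 1
    ext x
    simp [le_iff_lt_or_eq]
  have hfinlt : μ {x | f x < l} ≠ ⊤ := (hl₁.trans_lt ht').ne
  -- The mass still to be taken from the plateau. A sublevel set of `g` provides exactly this
  -- amount, since level sets of `g` are null.
  set t' := t - μ {x | f x < l} with ht'_def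
  have htt : μ {x | f x < l} + t' = t := add_tsub_cancel_of_le hl₁
  have ht'pos : 0 < t' := tsub_pos_of_lt h1
  have ht'lt : t' < μ.restrict {x | f x = l} Set.univ := by
    rw [hle, ← htt] at h2
    exact (ENNReal.add_lt_add_iff_left hfinlt).1 h2
  have hνfin : ∀ a, μ.restrict {x | f x = l} {x | g x ≤ a} < ⊤ := by
    intro a
    refine lt_of_le_of_lt (measure_mono (Set.subset_univ _)) ?_
    rw [Measure.restrict_apply_univ]
    exact lt_of_le_of_lt (measure_mono fun x hx => le_of_eq hx) (hfin l)
  obtain ⟨a₁, ha₁⟩ := exists_le_measure_le_of_lt_measure_univ _ g ht'lt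
  obtain ⟨r, hr₁, hr₂⟩ := exists_measure_lt_le_le_measure_le _ hg hg0 hνfin ht'pos ha₁
  have hreq : μ.restrict {x | f x = l} {x | g x < r} = t' := by
    refine le_antisymm hr₁ (hr₂.trans ?_)
    have hsub : {x | g x ≤ r} = {x | g x < r} ∪ {x | g x = r} := by
      ext x; simp [le_iff_lt_or_eq]
    rw [hsub]
    refine (measure_union_le _ _).trans ?_
    have : μ.restrict {x | f x = l} {x | g x = r} = 0 :=
      le_antisymm ((Measure.restrict_apply_le _ _).trans (hgnull r).le) zero_le
    rw [this, add_zero]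
  refine ⟨{x | f x < l} ∪ ({x | g x < r} ∩ {x | f x = l}), ?_, ?_, ?_⟩
  · rw [split _ (measurableSet_lt hg measurable_const), hreq, htt]
  · rintro y (hy | ⟨hy, hy'⟩) x (hx | ⟨hx, hx'⟩)
    · exact Or.inl (hx.trans hy)
    · exact Or.inl (hx.trans_lt hy)
    · exact Or.inl (lt_of_lt_of_eq hx hy')
    · exact Or.inr ⟨hx'.trans hy, hx.trans hy'⟩
  · intro y hy x hx
    simp only [Set.mem_union, Set.mem_ofPred_eq, Set.mem_inter_iff, not_or, not_and', not_lt] at hy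
    rcases hx with hx | ⟨hx, hx'⟩
    · exact Or.inl (lt_of_lt_of_le hx hy.1)
    · rcases hy.1.eq_or_lt with h | h
      · exact Or.inr ⟨hx'.trans h, lt_of_lt_of_le hx (hy.2 h.symm)⟩
      · exact Or.inl (lt_of_eq_of_lt hx' h)

/-- An initial segment `S` of measure `t` is squeezed between `{rank < t}` and `{rank ≤ t}`:
segments of points of `S` lie in `S`, and segments of points outside contain `S`. -/
theorem measure_lexRank_lt (hf : Measurable f) (hg : Measurable g) (hf0 : ∀ x, 0 ≤ f x)
    (hg0 : ∀ x, 0 ≤ g x) (hfin : ∀ a, μ {x | f x ≤ a} < ⊤) (huniv : μ Set.univ = ⊤)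
    (hgnull : ∀ c, μ {x | g x = c} = 0) (t : ℝ) :
    μ {y | lexRank μ f g y < t} = ENNReal.ofReal t := by
  have key : ∀ t : ℝ, 0 < t → ∃ S, μ S = ENNReal.ofReal t ∧
      {y | lexRank μ f g y < t} ⊆ S ∧ S ⊆ {y | lexRank μ f g y ≤ t} := by
    intro t ht
    obtain ⟨S, hS, hS₁, hS₂⟩ := exists_initial_segment (g := g) hf hg hf0 hg0 hfin huniv hgnull
      (ENNReal.ofReal_pos.2 ht) ENNReal.ofReal_lt_top
    have hSr : μ.real S = t := by rw [Measure.real, hS, ENNReal.toReal_ofReal ht.le]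
    refine ⟨S, hS, fun y hy => ?_, fun y hy => ?_⟩
    · by_contra hyS
      refine (not_lt.2 ?_) (Set.mem_ofPred.1 hy)
      rw [← hSr]
      exact measureReal_mono (hS₂ y hyS) (measure_lexBelow_lt_top hfin y).ne
    · change μ.real _ ≤ t
      rw [← hSr]
      exact measureReal_mono (hS₁ y hy) (hS ▸ ENNReal.ofReal_ne_top)
  rcases le_or_gt t 0 with ht | ht
  · have : {y | lexRank μ f g y < t} = ∅ := by
      ext y
      simp only [Set.mem_ofPred_eq, Set.mem_empty_iff_false, iff_false, not_lt]
      exact ht.trans measureReal_nonneg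
    rw [this, measure_empty, ENNReal.ofReal_of_nonpos ht]
  · apply le_antisymm
    · obtain ⟨S, hS, h1, -⟩ := key t ht
      exact hS ▸ measure_mono h1
    -- For the lower bound, use the segment of measure `d < t`: its points have rank at most `d`,
    -- hence less than `t`.
    · refine le_of_forall_lt fun c hc => ?_
      obtain ⟨d, hcd, hdt⟩ := exists_between hc
      have hd : d ≠ ⊤ := (hdt.trans ENNReal.ofReal_lt_top).ne
      have hdpos : 0 < d.toReal := ENNReal.toReal_pos ((zero_le (a := c)).trans_lt hcd).ne' hd
      obtain ⟨S, hS, -, h2⟩ := key d.toReal hdpos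
      rw [ENNReal.ofReal_toReal hd] at hS
      refine hcd.trans_le (hS ▸ measure_mono fun y hy =>
        Set.mem_ofPred.2 (lt_of_le_of_lt (Set.mem_ofPred.1 (h2 hy)) ?_))
      exact (ENNReal.lt_ofReal_iff_toReal_lt hd).1 hdt

theorem measurePreserving_lexRank (hf : Measurable f) (hg : Measurable g) (hf0 : ∀ x, 0 ≤ f x)
    (hg0 : ∀ x, 0 ≤ g x) (hfin : ∀ a, μ {x | f x ≤ a} < ⊤) (huniv : μ Set.univ = ⊤)
    (hgnull : ∀ c, μ {x | g x = c} = 0) (hmeas : Measurable (lexRank μ f g)) :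
    MeasurePreserving (lexRank μ f g) μ (volume.restrict (Set.Ici (0 : ℝ))) := by
  refine ⟨hmeas, ?_⟩
  symm
  refine Measure.ext_of_Ico _ _ fun a b hab => ?_
  have hIco : lexRank μ f g ⁻¹' Set.Ico a b =
      {y | lexRank μ f g y < b} \ {y | lexRank μ f g y < a} := by
    ext y; simp [and_comm]
  have hlt := measure_lexRank_lt (g := g) hf hg hf0 hg0 hfin huniv hgnull
  rw [Measure.map_apply hmeas measurableSet_Ico, Measure.restrict_apply measurableSet_Ico, hIco,
    measure_sdiff (Set.ofPred_subset_ofPred.2 fun y hy => lt_trans hy hab)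
      (measurableSet_lt hmeas measurable_const).nullMeasurableSet
      (by rw [hlt]; exact ENNReal.ofReal_ne_top), hlt, hlt, Set.Ico_inter_Ici, Real.volume_Ico]
  rcases le_total a 0 with ha | ha
  · rw [sup_eq_right.2 ha, ENNReal.ofReal_of_nonpos ha, sub_zero, tsub_zero]
  · rw [sup_eq_left.2 ha, ENNReal.ofReal_sub _ ha]

/-- Joint measurability of the rank of the slices of a measurable function. -/
theorem measurable_lexRank_uncurry {β : Type*} [MeasurableSpace β] [SFinite μ] {F : β → α → ℝ}
    (hF : Measurable (Function.uncurry F)) (hg : Measurable g) :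
    Measurable fun q : β × α => lexRank μ (F q.1) g q.2 := by
  have h1 : Measurable fun p : (β × α) × α => F p.1.1 p.2 :=
    hF.comp ((measurable_fst.comp measurable_fst).prodMk measurable_snd)
  have h2 : Measurable fun p : (β × α) × α => F p.1.1 p.1.2 := hF.comp measurable_fst
  have h3 : Measurable fun p : (β × α) × α => g p.2 := hg.comp measurable_snd
  have h4 : Measurable fun p : (β × α) × α => g p.1.2 :=
    hg.comp (measurable_snd.comp measurable_fst)
  -- The rank is the measure of the section of one measurable subset of `(β × α) × α`.
  exact (measurable_measure_prodMk_left (ν := μ)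
    ((measurableSet_lt h1 h2).union
      ((measurableSet_eq_fun h1 h2).inter (measurableSet_lt h3 h4)))).ennreal_toReal

end LexRank

/-! ### The bathtub principle. -/

section Bathtub

variable {α : Type*} [MeasurableSpace α] {μ : Measure α}

/-- After removing `A ∩ B`, the remainders have equal measure, and the supremum `c` of `f` over `B`
separates the values of `f` on them. -/
theorem setLIntegral_le_of_forall_mem_le {f : α → ℝ≥0∞} {A B : Set α} (hA : MeasurableSet A)
    (hB : MeasurableSet B) (hAB : μ A = μ B) (hfin : μ B ≠ ⊤)
    (h : ∀ x ∈ B, ∀ y ∉ B, f x ≤ f y) : ∫⁻ x in B, f x ∂μ ≤ ∫⁻ x in A, f x ∂μ := by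
  set c : ℝ≥0∞ := ⨆ x ∈ B, f x
  have hdiff : μ (B \ A) = μ (A \ B) := by
    have h1 := measure_sdiff_add_inter (μ := μ) B hA
    have h2 := measure_sdiff_add_inter (μ := μ) A hB
    rw [hAB, ← h1, Set.inter_comm A B] at h2
    exact ((ENNReal.add_left_inj (measure_ne_top_of_subset Set.inter_subset_left hfin)).1 h2).symm
  rw [← lintegral_inter_add_sdiff f B hA, ← lintegral_inter_add_sdiff f A hB, Set.inter_comm A B]
  gcongr 1 with x
  calc ∫⁻ x in B \ A, f x ∂μ ≤ ∫⁻ _ in B \ A, c ∂μ :=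
        setLIntegral_mono' (hB.diff hA) fun x hx => le_biSup f hx.1
    _ = ∫⁻ _ in A \ B, c ∂μ := by rw [setLIntegral_const, setLIntegral_const, hdiff]
    _ ≤ ∫⁻ x in A \ B, f x ∂μ :=
        setLIntegral_mono' (hA.diff hB) fun y hy => iSup₂_le fun x hx => h x hx y hy.2

/-- Layer-cake formula for `K` under the measure `f dμ`; the superlevel sets of `K₁` and `K₂` are
then compared level by level. -/
theorem lintegral_mul_le_of_equimeasurable {f : α → ℝ≥0∞} (hf : Measurable f) {K₁ K₂ : α → ℝ}
    (hK₁ : Measurable K₁) (hK₂ : Measurable K₂) (h₁ : ∀ x, 0 ≤ K₁ x) (h₂ : ∀ x, 0 ≤ K₂ x)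
    (heq : ∀ m : ℝ, 0 < m → μ {x | m < K₁ x} = μ {x | m < K₂ x})
    (hfin : ∀ m : ℝ, 0 < m → μ {x | m < K₂ x} ≠ ⊤)
    (hmono : ∀ x y, K₂ y < K₂ x → f x ≤ f y) :
    ∫⁻ x, f x * ENNReal.ofReal (K₂ x) ∂μ ≤ ∫⁻ x, f x * ENNReal.ofReal (K₁ x) ∂μ := by
  have layer : ∀ K : α → ℝ, Measurable K → (∀ x, 0 ≤ K x) →
      ∫⁻ x, f x * ENNReal.ofReal (K x) ∂μ =
        ∫⁻ m in Set.Ioi (0 : ℝ), ∫⁻ x in {x | m < K x}, f x ∂μ := by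
    intro K hK hK0
    have := lintegral_eq_lintegral_meas_lt (μ.withDensity f) (f := K)
      (Filter.Eventually.of_forall hK0) hK.aemeasurable
    rw [lintegral_withDensity_eq_lintegral_mul _ hf hK.ennreal_ofReal] at this
    refine this.trans (lintegral_congr fun m => ?_)
    rw [withDensity_apply _ (measurableSet_lt measurable_const hK)]
  rw [layer _ hK₁ h₁, layer _ hK₂ h₂]
  refine setLIntegral_mono' measurableSet_Ioi fun m hm => ?_
  exact setLIntegral_le_of_forall_mem_le (measurableSet_lt measurable_const hK₁)
    (measurableSet_lt measurable_const hK₂) (heq m hm) (hfin m hm)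
    fun x hx y hy => hmono x y ((not_lt.1 hy).trans_lt hx)

end Bathtub

/-! ### The splitting $\mathbb{R}^n=\mathbb{R}^k\times\mathbb{R}^{n-k}$ and Tonelli's theorem. -/

section JoinPoint

/-- The splitting of `n` coordinates into the first `k` and the last `n - k`. -/
def splitEquiv {n k : ℕ} (h : k ≤ n) : Fin k ⊕ Fin (n - k) ≃ Fin n :=
  finSumFinEquiv.trans (finCongr (Nat.add_sub_of_le h))

variable {n k : ℕ}

theorem joinPoint_splitEquiv_inl (h : k ≤ n) (y : EuclideanSpace ℝ (Fin k))
    (z : EuclideanSpace ℝ (Fin (n - k))) (i : Fin k) :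
    joinPoint y z (splitEquiv h (Sum.inl i)) = y i := by
  simp [joinPoint, splitEquiv]

theorem joinPoint_splitEquiv_inr (h : k ≤ n) (y : EuclideanSpace ℝ (Fin k))
    (z : EuclideanSpace ℝ (Fin (n - k))) (j : Fin (n - k)) :
    joinPoint y z (splitEquiv h (Sum.inr j)) = z j := by
  simp [joinPoint, splitEquiv]

theorem norm_joinPoint_sq (h : k ≤ n) (y : EuclideanSpace ℝ (Fin k))
    (z : EuclideanSpace ℝ (Fin (n - k))) : ‖joinPoint y z‖ ^ 2 = ‖y‖ ^ 2 + ‖z‖ ^ 2 := by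
  simp only [EuclideanSpace.norm_sq_eq]
  rw [← Equiv.sum_comp (splitEquiv h), Fintype.sum_sum_type]
  simp only [joinPoint_splitEquiv_inl, joinPoint_splitEquiv_inr]

/-- The first `k` coordinates. -/
noncomputable def headPart (h : k ≤ n) (x : EuclideanSpace ℝ (Fin n)) : EuclideanSpace ℝ (Fin k) :=
  WithLp.toLp 2 fun i => x (splitEquiv h (Sum.inl i))

/-- The last `n - k` coordinates. -/
noncomputable def tailPart (h : k ≤ n) (x : EuclideanSpace ℝ (Fin n)) :
    EuclideanSpace ℝ (Fin (n - k)) :=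
  WithLp.toLp 2 fun i => x (splitEquiv h (Sum.inr i))

theorem headPart_joinPoint (h : k ≤ n) (y : EuclideanSpace ℝ (Fin k))
    (z : EuclideanSpace ℝ (Fin (n - k))) : headPart h (joinPoint y z) = y := by
  ext i; exact joinPoint_splitEquiv_inl h y z i

theorem tailPart_joinPoint (h : k ≤ n) (y : EuclideanSpace ℝ (Fin k))
    (z : EuclideanSpace ℝ (Fin (n - k))) : tailPart h (joinPoint y z) = z := by
  ext i; exact joinPoint_splitEquiv_inr h y z i

theorem measurable_headPart (h : k ≤ n) : Measurable (headPart h) := by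
  unfold headPart; fun_prop

theorem measurable_tailPart (h : k ≤ n) : Measurable (tailPart h) := by
  unfold tailPart; fun_prop

theorem joinPoint_headPart_tailPart (h : k ≤ n) (x : EuclideanSpace ℝ (Fin n)) :
    joinPoint (headPart h x) (tailPart h x) = x := by
  ext i
  obtain ⟨j, rfl⟩ := (splitEquiv h).surjective i
  rcases j with j | j
  · rw [joinPoint_splitEquiv_inl, headPart]
  · rw [joinPoint_splitEquiv_inr, tailPart]

theorem measurePreserving_joinPoint (h : k ≤ n) :
    MeasurePreserving (fun q : EuclideanSpace ℝ (Fin (n - k)) × EuclideanSpace ℝ (Fin k) =>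
      joinPoint q.2 q.1) (volume.prod volume) volume := by
  have h1 : MeasurePreserving
      (Prod.map (WithLp.ofLp (p := 2) (V := Fin k → ℝ))
        (WithLp.ofLp (p := 2) (V := Fin (n - k) → ℝ)))
      (volume.prod volume) (volume.prod volume) :=
    (PiLp.volume_preserving_ofLp (Fin k)).prod (PiLp.volume_preserving_ofLp (Fin (n - k)))
  have h2 := volume_measurePreserving_sumPiEquivProdPi_symm
    (fun _ : Fin k ⊕ Fin (n - k) => ℝ)
  have h3 := volume_measurePreserving_piCongrLeft (fun _ : Fin n => ℝ) (splitEquiv h)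
  have h4 := PiLp.volume_preserving_toLp (Fin n)
  have h5 := h4.comp (h3.comp (h2.comp (h1.comp Measure.measurePreserving_swap)))
  convert! h5 using 1
  funext q
  ext i
  obtain ⟨j, rfl⟩ := (splitEquiv h).surjective i
  simp only [Function.comp_apply, MeasurableEquiv.coe_piCongrLeft, Equiv.piCongrLeft_apply_apply]
  rcases j with j | j
  · rw [joinPoint_splitEquiv_inl]; rfl
  · rw [joinPoint_splitEquiv_inr]; rfl

theorem measurable_joinPoint (h : k ≤ n) :
    Measurable (fun q : EuclideanSpace ℝ (Fin (n - k)) × EuclideanSpace ℝ (Fin k) =>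
      joinPoint q.2 q.1) := (measurePreserving_joinPoint h).measurable

theorem lintegral_eq_lintegral_joinPoint (h : k ≤ n) {F : EuclideanSpace ℝ (Fin n) → ℝ≥0∞}
    (hF : Measurable F) : 
    ∫⁻ x, F x = ∫⁻ z : EuclideanSpace ℝ (Fin (n - k)), ∫⁻ y : EuclideanSpace ℝ (Fin k),
      F (joinPoint y z) := by
  rw [← (measurePreserving_joinPoint h).lintegral_comp hF]
  exact lintegral_prod _ (hF.comp (measurable_joinPoint h)).aemeasurable

end JoinPoint

/-! ### Kernels built from rearrangements, and their admissibility. -/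

section Kernel

/-- The profile `(a, ζ) ↦ ((a / ω_k) ^ (2 / k) + ζ²) ^ (-(n + 2s) / 2)`, zero where the base
vanishes. -/
noncomputable def kernelProfile (n k : ℕ) (s a ζ : ℝ) : ℝ :=
  1 / (((unitBallVolume k)⁻¹ * a) ^ (2 / (k : ℝ)) + ζ ^ 2) ^ (((n : ℝ) + 2 * s) / 2)

/-- The kernel on `ℝⁿ` built from the slice rearrangements `σ`. -/
noncomputable def rearrangedKernel {n k : ℕ} (h : k ≤ n) (s : ℝ)
    (σ : EuclideanSpace ℝ (Fin (n - k)) → EuclideanSpace ℝ (Fin k) → ℝ)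
    (x : EuclideanSpace ℝ (Fin n)) : ℝ :=
  kernelProfile n k s (σ (tailPart h x) (headPart h x)) ‖tailPart h x‖

variable {n k : ℕ}

theorem rearrangedKernel_joinPoint (h : k ≤ n) (s : ℝ)
    (σ : EuclideanSpace ℝ (Fin (n - k)) → EuclideanSpace ℝ (Fin k) → ℝ)
    (y : EuclideanSpace ℝ (Fin k)) (z : EuclideanSpace ℝ (Fin (n - k))) :
    rearrangedKernel h s σ (joinPoint y z) = kernelProfile n k s (σ z y) ‖z‖ := by
  rw [rearrangedKernel, headPart_joinPoint, tailPart_joinPoint]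

theorem unitBallVolume_pos (k : ℕ) : 0 < unitBallVolume k :=
  ENNReal.toReal_pos (Metric.measure_ball_pos _ _ one_pos).ne' measure_ball_lt_top.ne

theorem volume_ball_zero (hk : 1 ≤ k) {R : ℝ} (hR : 0 ≤ R) :
    volume (Metric.ball (0 : EuclideanSpace ℝ (Fin k)) R) =
      ENNReal.ofReal (unitBallVolume k * R ^ k) := by
  have : Nonempty (Fin k) := ⟨⟨0, hk⟩⟩
  rw [Measure.addHaar_ball _ _ hR, finrank_euclideanSpace_fin, mul_comm,
    ENNReal.ofReal_mul (unitBallVolume_pos k).le, unitBallVolume,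
    ENNReal.ofReal_toReal measure_ball_lt_top.ne]

/-- The condition `0 < b` reflects `1 / 0 = 0`: the kernel vanishes where its base does. -/
theorem rpow_neg_lt_one_div_rpow_iff {b r q : ℝ} (hb : 0 ≤ b) (hr : 0 < r) (hq : 0 < q) :
    r ^ (-(2 * q)) < 1 / b ^ q ↔ 0 < b ∧ b < r ^ 2 := by
  have h2 : r ^ (-(2 * q)) = 1 / (r ^ 2) ^ q := by
    rw [Real.rpow_neg hr.le, Real.rpow_mul hr.le, one_div, Real.rpow_two]
  rw [h2]
  rcases hb.eq_or_lt with rfl | hb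
  · simp only [Real.zero_rpow hq.ne', div_zero, lt_self_iff_false, false_and, iff_false, not_lt]
    positivity
  · rw [one_div_lt_one_div (by positivity) (by positivity),
      Real.rpow_lt_rpow_iff hb.le (by positivity) hq]
    simp [hb]

theorem kernelProfile_nonneg (n k : ℕ) (s : ℝ) {a : ℝ} (ha : 0 ≤ a) (ζ : ℝ) :
    0 ≤ kernelProfile n k s a ζ := by
  have := unitBallVolume_pos k
  unfold kernelProfile
  positivity

theorem measurable_rearrangedKernel (h : k ≤ n) (s : ℝ)
    {σ : EuclideanSpace ℝ (Fin (n - k)) → EuclideanSpace ℝ (Fin k) → ℝ}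
    (hσ : Measurable fun q : EuclideanSpace ℝ (Fin (n - k)) × EuclideanSpace ℝ (Fin k) =>
      σ q.1 q.2) : Measurable (rearrangedKernel h s σ) := by
  have h1 : Measurable fun x => σ (tailPart h x) (headPart h x) :=
    hσ.comp ((measurable_tailPart h).prodMk (measurable_headPart h))
  have h2 := (measurable_tailPart h).norm
  exact ((((h1.const_mul _).pow_const _).add (h2.pow_const 2)).pow_const _).const_div 1

/-- The threshold for `a` is the volume of the ball of radius `√d` in $\mathbb{R}^k$, as in the
definition of admissibility. -/
theorem rpow_base_lt_iff (hk : 1 ≤ k) {a d : ℝ} (ha : 0 ≤ a) (hd : 0 ≤ d) :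
    ((unitBallVolume k)⁻¹ * a) ^ (2 / (k : ℝ)) < d ↔ a < unitBallVolume k * Real.sqrt d ^ k := by
  have hω := unitBallVolume_pos k
  have hk' : (0 : ℝ) < k := by exact_mod_cast hk
  have hdd : d = (Real.sqrt d ^ k) ^ (2 / (k : ℝ)) := by
    rw [← Real.rpow_natCast, ← Real.rpow_mul (Real.sqrt_nonneg d), mul_div_cancel₀ _ hk'.ne',
      Real.rpow_two, Real.sq_sqrt hd]
  nth_rewrite 1 [hdd]
  rw [Real.rpow_lt_rpow_iff (by positivity) (by positivity) (by positivity), inv_mul_lt_iff₀ hω]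

/-- Only the distribution function of each `σ z` matters: up to a null set, the superlevel set of
the kernel is `{σ z < T}`, with `T` the prescribed ball volume. -/
theorem rearrangedKernel_mem_admissibleKernels (hk : 1 ≤ k) (h : k ≤ n) {s : ℝ} (hs : 0 < s)
    {σ : EuclideanSpace ℝ (Fin (n - k)) → EuclideanSpace ℝ (Fin k) → ℝ}
    (hσ0 : ∀ z y, 0 ≤ σ z y)
    (hσ : Measurable fun q : EuclideanSpace ℝ (Fin (n - k)) × EuclideanSpace ℝ (Fin k) =>
      σ q.1 q.2)
    (hlt : ∀ z t, volume {y | σ z y < t} = ENNReal.ofReal t) :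
    rearrangedKernel h s σ ∈ admissibleKernels n k s := by
  have hω := unitBallVolume_pos k
  refine ⟨measurable_rearrangedKernel h s hσ,
    fun x => kernelProfile_nonneg n k s (hσ0 _ _) _, fun z r hr => ?_⟩
  set b : EuclideanSpace ℝ (Fin k) → ℝ :=
    fun y => ((unitBallVolume k)⁻¹ * σ z y) ^ (2 / (k : ℝ)) + ‖z‖ ^ 2 with hb
  have hb0 : ∀ y, 0 ≤ b y := fun y => by
    have := hσ0 z y
    simp only [hb]
    positivity
  have hset : {y : EuclideanSpace ℝ (Fin k) |
      r ^ (-(n : ℝ) - 2 * s) < rearrangedKernel h s σ (joinPoint y z)} =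
      {y | 0 < b y ∧ b y < r ^ 2} := by
    ext y
    have := rpow_neg_lt_one_div_rpow_iff (hb0 y) hr (q := ((n : ℝ) + 2 * s) / 2) (by positivity)
    rw [Set.mem_ofPred_eq, Set.mem_ofPred_eq, rearrangedKernel_joinPoint, ← this, kernelProfile]
    rw [show -(n : ℝ) - 2 * s = -(2 * (((n : ℝ) + 2 * s) / 2)) by ring]
  rw [hset]
  split_ifs with hz
  · have hd : 0 ≤ r ^ 2 - ‖z‖ ^ 2 := by
      have := norm_nonneg z
      nlinarith
    set T := unitBallVolume k * Real.sqrt (r ^ 2 - ‖z‖ ^ 2) ^ k with hT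
    rw [volume_ball_zero hk (Real.sqrt_nonneg _), ← hT, ← hlt z T]
    have hiff : ∀ y, b y < r ^ 2 ↔ σ z y < T := fun y => by
      rw [← rpow_base_lt_iff hk (hσ0 z y) hd, lt_sub_iff_add_lt]
    -- The base vanishes only where `σ z` does, and that set lies in `{σ z < d}`, of measure `d`,
    -- for every `d > 0`.
    have hnull : volume {y | b y = 0} = 0 := by
      refine le_antisymm (le_of_forall_gt fun c hc => ?_) zero_le
      obtain ⟨d, hd0, hdc⟩ := exists_between hc
      have hd : d ≠ ⊤ := (hdc.trans_le le_top).ne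
      refine lt_of_le_of_lt ?_ hdc
      rw [← ENNReal.ofReal_toReal hd, ← hlt z]
      refine measure_mono fun y hy => ?_
      have hdpos : 0 < d.toReal := ENNReal.toReal_pos hd0.ne' hd
      rw [Set.mem_ofPred_eq] at hy ⊢
      by_contra! hle
      have : 0 < σ z y := hdpos.trans_le hle
      have : 0 < b y := by simp only [hb]; positivity
      exact this.ne' hy
    refine measure_congr ?_
    filter_upwards [measure_eq_zero_iff_ae_notMem.1 hnull] with y hy
    have hpos : 0 < b y := lt_of_le_of_ne (hb0 y) (Ne.symm hy)
    exact propext ⟨fun hx => (hiff y).1 hx.2, fun hx => ⟨hpos, (hiff y).2 hx⟩⟩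
  · convert measure_empty (μ := volume)
    ext y
    simp only [Set.mem_ofPred_eq, Set.mem_empty_iff_false, iff_false, not_and, not_lt]
    intro _
    have : 0 ≤ ((unitBallVolume k)⁻¹ * σ z y) ^ (2 / (k : ℝ)) := by
      have := hσ0 z y
      positivity
    have hz' : r ^ 2 ≤ ‖z‖ ^ 2 := by gcongr; exact not_lt.1 hz
    simp only [hb]
    linarith

/-- The radial kernel of the fractional Laplacian is admissible. -/
theorem norm_rpow_mem_admissibleKernels (hk : 1 ≤ k) (h : k ≤ n) {s : ℝ} (hs : 0 < s) :
    (fun x : EuclideanSpace ℝ (Fin n) => 1 / ‖x‖ ^ ((n : ℝ) + 2 * s)) ∈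
      admissibleKernels n k s := by
  have hω := unitBallVolume_pos k
  have hk' : (0 : ℝ) < k := by exact_mod_cast hk
  -- With this choice $(\sigma/\omega_k)^{2/k}=|y|^2$, so the base becomes $|y|^2+|z|^2=|x|^2$.
  set σ : EuclideanSpace ℝ (Fin (n - k)) → EuclideanSpace ℝ (Fin k) → ℝ :=
    fun _ y => unitBallVolume k * ‖y‖ ^ k with hσ
  have hmem := rearrangedKernel_mem_admissibleKernels hk h hs (σ := σ)
    (fun z y => by simp only [hσ]; positivity) (by simp only [hσ]; fun_prop) ?_
  · convert hmem using 1
    funext x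
    obtain ⟨y, z, rfl⟩ : ∃ y z, joinPoint (n := n) (k := k) y z = x :=
      ⟨_, _, joinPoint_headPart_tailPart h x⟩
    rw [rearrangedKernel_joinPoint, kernelProfile, inv_mul_cancel_left₀ hω.ne',
      ← Real.rpow_natCast ‖y‖ k, ← Real.rpow_mul (norm_nonneg y), mul_div_cancel₀ _ hk'.ne',
      Real.rpow_two, ← norm_joinPoint_sq h, ← Real.rpow_two, ← Real.rpow_mul (norm_nonneg _)]
    congr 2
    ring
  · intro z t
    rcases le_or_gt t 0 with ht | ht
    · rw [ENNReal.ofReal_of_nonpos ht]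
      convert measure_empty (μ := volume)
      ext y
      simp only [Set.mem_ofPred_eq, Set.mem_empty_iff_false, iff_false, not_lt]
      refine ht.trans ?_
      positivity
    · set R : ℝ := ((unitBallVolume k)⁻¹ * t) ^ ((k : ℝ)⁻¹) with hR
      have hR0 : 0 ≤ R := by positivity
      have hRk : unitBallVolume k * R ^ k = t := by
        rw [hR, Real.rpow_inv_natCast_pow (by positivity) (by omega), mul_inv_cancel_left₀ hω.ne']
      rw [← hRk, ← volume_ball_zero hk hR0]
      congr 1
      ext y
      rw [Set.mem_ofPred_eq, mem_ball_zero_iff, mul_lt_mul_iff_right₀ hω,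
        pow_lt_pow_iff_left₀ (norm_nonneg y) hR0 (by omega)]

end Kernel

/-! ### Integrability against the radial kernel. -/

section Finiteness

variable {n : ℕ} {u : EuclideanSpace ℝ (Fin n) → ℝ} {x₀ : EuclideanSpace ℝ (Fin n)}

/-- `C^{1,1}` regularity at a point is a quadratic bound on the linearized increment. -/
theorem IsC11At.exists_linearizedIncrement_le (h : IsC11At u x₀) : ∃ ρ C : ℝ, 0 < ρ ∧ 0 < C ∧
    ∀ x ∈ Metric.ball (0 : EuclideanSpace ℝ (Fin n)) ρ,
      |linearizedIncrement u x₀ x| ≤ C * ‖x‖ ^ 2 := by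
  obtain ⟨p, ρ, C, hρ, hC, hb⟩ := h
  -- The quadratic bound forces differentiability, so `gradient u x₀` is `p` and not a default
  -- value.
  have hgrad : HasGradientAt u p x₀ := by
    rw [hasGradientAt_iff_isLittleO_nhds_zero]
    refine Asymptotics.IsBigO.trans_isLittleO (g := fun x => ‖x‖ ^ 2) ?_
      (Asymptotics.isLittleO_norm_pow_id one_lt_two)
    refine Asymptotics.IsBigO.of_bound C ?_
    filter_upwards [Metric.ball_mem_nhds _ hρ] with x hx
    rw [Real.norm_eq_abs, Real.norm_of_nonneg (by positivity), real_inner_comm]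
    exact hb x hx
  refine ⟨ρ, C, hρ, hC, fun x hx => ?_⟩
  rw [linearizedIncrement, hgrad.gradient]
  exact hb x hx

theorem measurable_linearizedIncrement (hu : Continuous u) :
    Measurable (linearizedIncrement u x₀) := by
  unfold linearizedIncrement
  exact Continuous.measurable (by fun_prop)

/-- Near the origin the integrand is at most $C|x|^{2-n-2s}$, integrable since $s<1$. Far away,
`hint` controls $u$, and the linear term gives $|x|^{1-n-2s}$, integrable since $s>1/2$. -/
theorem integrable_linearizedIncrement_div_norm_rpow (hn : 1 ≤ n) {s : ℝ} (hs : 1 / 2 < s)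
    (hs' : s < 1) (hu : Continuous u) (hu11 : IsC11At u x₀)
    (hint : Integrable (fun x => |u x| / (1 + ‖x‖) ^ ((n : ℝ) + 2 * s)) volume) :
    Integrable (fun x => linearizedIncrement u x₀ x * (1 / ‖x‖ ^ ((n : ℝ) + 2 * s))) volume := by
  set q : ℝ := (n : ℝ) + 2 * s with hq
  have hq0 : 0 < q := by positivity
  have hmeas : Measurable fun x => linearizedIncrement u x₀ x * (1 / ‖x‖ ^ q) :=
    (measurable_linearizedIncrement hu).mul ((measurable_norm.pow_const q).const_div 1)
  obtain ⟨ρ, C, hρ, hC, hb⟩ := hu11.exists_linearizedIncrement_le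
  have hnear : IntegrableOn (fun x => linearizedIncrement u x₀ x * (1 / ‖x‖ ^ q))
      (Metric.ball 0 ρ) volume := by
    refine integrableOn_ball_of_norm_le_rpow (C := C) (α := q - 2) (by simpa using hn)
      (by rw [finrank_euclideanSpace_fin]; linarith) ?_ hmeas.aestronglyMeasurable
    filter_upwards [ae_restrict_mem Metric.isOpen_ball.measurableSet] with x hx
    rcases (norm_nonneg x).eq_or_lt with h0 | h0
    · rw [← h0, Real.zero_rpow hq0.ne', div_zero, mul_zero, norm_zero]
      positivity
    · rw [norm_mul, Real.norm_eq_abs, Real.norm_of_nonneg (by positivity), neg_sub,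
        Real.rpow_sub h0, Real.rpow_two, mul_one_div, ← mul_div_assoc]
      gcongr
      exact hb x hx
  have hfar : IntegrableOn (fun x => linearizedIncrement u x₀ x * (1 / ‖x‖ ^ q))
      (Metric.ball 0 ρ)ᶜ volume := by
    -- Chosen so that $1+|x_0|+|x|\le L|x|$ for $|x|\ge\rho$; this dominates the radial kernel by
    -- the weights at both $x$ and $x_0+x$.
    set L : ℝ := (1 + ‖x₀‖) / ρ + 1 with hL
    have hL0 : 0 < L := by positivity
    have i1 : Integrable (fun x => |u (x₀ + x)| / (1 + ‖x₀ + x‖) ^ q) volume :=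
      hint.comp_add_left x₀
    have i2 : Integrable (fun x : EuclideanSpace ℝ (Fin n) => (1 + ‖x‖) ^ (-q)) volume :=
      integrable_one_add_norm (by rw [finrank_euclideanSpace_fin]; linarith)
    have i3 : Integrable (fun x : EuclideanSpace ℝ (Fin n) => (1 + ‖x‖) ^ (-(q - 1))) volume :=
      integrable_one_add_norm (by rw [finrank_euclideanSpace_fin]; linarith)
    refine Integrable.mono' (((i1.add (i2.const_mul |u x₀|)).add
      (i3.const_mul ‖gradient u x₀‖)).const_mul (L ^ q)).integrableOn
      hmeas.aestronglyMeasurable.restrict ?_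
    filter_upwards [ae_restrict_mem Metric.isOpen_ball.measurableSet.compl] with x hx
    have hxρ : ρ ≤ ‖x‖ := by simpa using hx
    have hx0 : 0 < ‖x‖ := hρ.trans_le hxρ
    have hLx : 1 + ‖x₀‖ + ‖x‖ ≤ L * ‖x‖ := by
      have : 1 + ‖x₀‖ ≤ (1 + ‖x₀‖) / ρ * ‖x‖ := by
        rw [div_mul_eq_mul_div, le_div_iff₀ hρ]
        gcongr
      rw [hL, add_mul, one_mul]
      linarith
    have hweight : ∀ a : ℝ, 1 ≤ a → a ≤ L * ‖x‖ → 1 / ‖x‖ ^ q ≤ L ^ q * (1 / a ^ q) := by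
      intro a ha haL
      rw [mul_one_div, div_le_div_iff₀ (by positivity) (by positivity), one_mul,
        ← Real.mul_rpow hL0.le hx0.le]
      gcongr
    have w1 := hweight (1 + ‖x₀ + x‖) (by linarith [norm_nonneg (x₀ + x)])
      (by linarith [norm_add_le x₀ x])
    have w2 := hweight (1 + ‖x‖) (by linarith) (by linarith [norm_nonneg x₀])
    have htri : |linearizedIncrement u x₀ x| ≤
        |u (x₀ + x)| + |u x₀| + ‖gradient u x₀‖ * (1 + ‖x‖) := by
      have h1 := abs_real_inner_le_norm x (gradient u x₀)
      have h2 : ‖x‖ * ‖gradient u x₀‖ ≤ ‖gradient u x₀‖ * (1 + ‖x‖) := by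
        rw [mul_comm]; gcongr; linarith
      calc |linearizedIncrement u x₀ x|
          ≤ |u (x₀ + x) - u x₀| + |inner ℝ x (gradient u x₀)| := abs_sub _ _
        _ ≤ |u (x₀ + x)| + |u x₀| + |inner ℝ x (gradient u x₀)| := by gcongr; exact abs_sub _ _
        _ ≤ _ := by linarith
    have e3 : (1 + ‖x‖) ^ (-(q - 1)) = (1 + ‖x‖) * (1 / (1 + ‖x‖) ^ q) := by
      rw [neg_sub, Real.rpow_sub (by positivity), Real.rpow_one, mul_one_div]
    have e2 : (1 + ‖x‖) ^ (-q) = 1 / (1 + ‖x‖) ^ q := by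
      rw [Real.rpow_neg (by positivity), one_div]
    rw [norm_mul, Real.norm_eq_abs, Real.norm_of_nonneg (by positivity)]
    calc |linearizedIncrement u x₀ x| * (1 / ‖x‖ ^ q)
        ≤ (|u (x₀ + x)| + |u x₀| + ‖gradient u x₀‖ * (1 + ‖x‖)) * (1 / ‖x‖ ^ q) := by gcongr
      _ = |u (x₀ + x)| * (1 / ‖x‖ ^ q) + |u x₀| * (1 / ‖x‖ ^ q) +
          ‖gradient u x₀‖ * (1 + ‖x‖) * (1 / ‖x‖ ^ q) := by ring
      _ ≤ |u (x₀ + x)| * (L ^ q * (1 / (1 + ‖x₀ + x‖) ^ q)) +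
          |u x₀| * (L ^ q * (1 / (1 + ‖x‖) ^ q)) +
          ‖gradient u x₀‖ * (1 + ‖x‖) * (L ^ q * (1 / (1 + ‖x‖) ^ q)) := by gcongr
      _ = _ := by
        simp only [Pi.add_apply, e2, e3]
        ring
  rw [← integrableOn_univ, ← Set.union_compl_self (Metric.ball 0 ρ)]
  exact hnear.union hfar

end Finiteness

/-! ### Optimality of the ranked kernel. -/

section Optimality

variable {n k : ℕ}

theorem volume_norm_eq_const (hk : 1 ≤ k) (c : ℝ) :
    volume {y : EuclideanSpace ℝ (Fin k) | ‖y‖ = c} = 0 := by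
  have : Nonempty (Fin k) := ⟨⟨0, hk⟩⟩
  have hset : {y : EuclideanSpace ℝ (Fin k) | ‖y‖ = c} = Metric.sphere 0 c := by ext y; simp
  rw [hset]
  exact Measure.addHaar_sphere _ _ _

/-- `ζ ≠ 0` keeps the base positive. For `ζ = 0` and `k ≥ 1` the profile takes the default value `0`
at `a = 0`, which breaks antitonicity. -/
theorem kernelProfile_lt_imp (n k : ℕ) {s a a' ζ : ℝ} (hs : 0 < s) (ha' : 0 ≤ a')
    (hζ : ζ ≠ 0) (h : kernelProfile n k s a' ζ < kernelProfile n k s a ζ) : a < a' := by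
  by_contra! hle
  have := unitBallVolume_pos k
  refine h.not_ge ?_
  unfold kernelProfile
  gcongr

/-- Among admissible kernels, the one monotone along slices with the function minimizes the
integral. -/
theorem lintegral_rearrangedKernel_le (hkn : k < n) {s : ℝ} (hs : 0 < s)
    {w : EuclideanSpace ℝ (Fin n) → ℝ} (hw : Measurable w) (hw0 : ∀ x, 0 ≤ w x)
    {σ : EuclideanSpace ℝ (Fin (n - k)) → EuclideanSpace ℝ (Fin k) → ℝ} (hσ0 : ∀ z y, 0 ≤ σ z y)
    (hmono : ∀ z y y', σ z y < σ z y' → w (joinPoint y z) ≤ w (joinPoint y' z))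
    (hadm : rearrangedKernel hkn.le s σ ∈ admissibleKernels n k s)
    {K : EuclideanSpace ℝ (Fin n) → ℝ} (hK : K ∈ admissibleKernels n k s) :
    ∫⁻ x, ENNReal.ofReal (w x * rearrangedKernel hkn.le s σ x) ≤
      ∫⁻ x, ENNReal.ofReal (w x * K x) := by
  set K₂ := rearrangedKernel hkn.le s σ with hK₂
  have hF : ∀ K' ∈ admissibleKernels n k s, Measurable fun x => ENNReal.ofReal (w x * K' x) :=
    fun K' hK' => (hw.mul hK'.1).ennreal_ofReal
  rw [lintegral_eq_lintegral_joinPoint hkn.le (hF _ hadm),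
    lintegral_eq_lintegral_joinPoint hkn.le (hF _ hK)]
  have : Nonempty (Fin (n - k)) := ⟨⟨0, by omega⟩⟩
  -- Since `k < n`, the slice `z = 0`, where antitonicity can fail, is negligible.
  have hz : ∀ᵐ z : EuclideanSpace ℝ (Fin (n - k)), z ≠ 0 := by
    simp [ae_iff]
  refine lintegral_mono_ae ?_
  filter_upwards [hz] with z hz
  have hslice : Measurable fun y : EuclideanSpace ℝ (Fin k) => joinPoint (n := n) y z :=
    (measurable_joinPoint hkn.le).comp measurable_prodMk_left
  simp only [ENNReal.ofReal_mul (hw0 _)]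
  have hlevel : ∀ m : ℝ, 0 < m → ∃ r : ℝ, 0 < r ∧ r ^ (-(n : ℝ) - 2 * s) = m := by
    intro m hm
    have hq : -(n : ℝ) - 2 * s ≠ 0 := by
      have : (0 : ℝ) ≤ n := n.cast_nonneg
      linarith
    exact ⟨m ^ (-(n : ℝ) - 2 * s)⁻¹, by positivity, Real.rpow_inv_rpow hm.le hq⟩
  refine lintegral_mul_le_of_equimeasurable (f := fun y => ENNReal.ofReal (w (joinPoint y z)))
    (hw.comp hslice).ennreal_ofReal (hK.1.comp hslice) (hadm.1.comp hslice)
    (fun _ => hK.2.1 _) (fun _ => hadm.2.1 _) ?_ ?_ ?_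
  · intro m hm
    obtain ⟨r, hr, rfl⟩ := hlevel m hm
    exact (hK.2.2 z r hr).trans (hadm.2.2 z r hr).symm
  · intro m hm
    obtain ⟨r, hr, rfl⟩ := hlevel m hm
    refine (lt_of_eq_of_lt (hadm.2.2 z r hr) ?_).ne
    split_ifs
    · exact measure_ball_lt_top
    · exact ENNReal.zero_lt_top
  · intro y y' hlt
    refine ENNReal.ofReal_le_ofReal (hmono z y y' ?_)
    simp only [hK₂, rearrangedKernel_joinPoint] at hlt
    exact kernelProfile_lt_imp n k hs (hσ0 z y') (norm_ne_zero_iff.2 hz) hlt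

/-- Existence of an optimal family of slice rearrangements for a nonnegative measurable function
whose slices have sublevel sets of finite measure. -/
theorem exists_optimal_rearrangement (hk : 1 ≤ k) (hkn : k < n) {s : ℝ} (hs : 0 < s)
    {w : EuclideanSpace ℝ (Fin n) → ℝ} (hw : Measurable w) (hw0 : ∀ x, 0 ≤ w x)
    (hlevel : ∀ (t : ℝ), 0 < t → ∀ z : EuclideanSpace ℝ (Fin (n - k)),
      volume {y : EuclideanSpace ℝ (Fin k) | w (joinPoint y z) ≤ t} < ⊤) :
    ∃ σ : EuclideanSpace ℝ (Fin (n - k)) → EuclideanSpace ℝ (Fin k) → ℝ,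
      (∀ z y, 0 ≤ σ z y) ∧
      (∀ z, MeasurePreserving (σ z) volume (volume.restrict (Set.Ici (0 : ℝ)))) ∧
      Measurable (fun q : EuclideanSpace ℝ (Fin (n - k)) × EuclideanSpace ℝ (Fin k) =>
        σ q.1 q.2) ∧
      rearrangedKernel hkn.le s σ ∈ admissibleKernels n k s ∧
      ∀ K ∈ admissibleKernels n k s,
        ∫⁻ x, ENNReal.ofReal (w x * rearrangedKernel hkn.le s σ x) ≤
          ∫⁻ x, ENNReal.ofReal (w x * K x) := by
  have : Nonempty (Fin k) := ⟨⟨0, hk⟩⟩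
  obtain ⟨F, hF⟩ : ∃ F : EuclideanSpace ℝ (Fin (n - k)) → EuclideanSpace ℝ (Fin k) → ℝ,
      ∀ z y, F z y = w (joinPoint y z) := ⟨_, fun _ _ => rfl⟩
  have hF0 : ∀ z y, 0 ≤ F z y := fun z y => hF z y ▸ hw0 _
  have hFmeas : Measurable (Function.uncurry F) := by
    have h := hw.comp (measurable_joinPoint hkn.le)
    have heq : Function.uncurry F =
        w ∘ fun q : EuclideanSpace ℝ (Fin (n - k)) × EuclideanSpace ℝ (Fin k) =>
          joinPoint q.2 q.1 := funext fun q => hF q.1 q.2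
    exact heq ▸ h
  have hFz : ∀ z, Measurable (F z) := fun z => hFmeas.comp measurable_prodMk_left
  -- `hlevel` covers positive levels only, hence the passage to `max a 1`.
  have hfin : ∀ z a, volume {y | F z y ≤ a} < ⊤ := by
    intro z a
    simp only [hF]
    exact lt_of_le_of_lt
      (measure_mono fun y hy => le_trans (Set.mem_ofPred.1 hy) (le_max_left a 1))
      (hlevel (max a 1) (by positivity) z)
  obtain ⟨σ, hσ⟩ : ∃ σ : EuclideanSpace ℝ (Fin (n - k)) → EuclideanSpace ℝ (Fin k) → ℝ,
      ∀ z, σ z = lexRank volume (F z) norm := ⟨_, fun _ => rfl⟩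
  have hσ0 : ∀ z y, 0 ≤ σ z y := fun z y => hσ z ▸ measureReal_nonneg
  have huniv : volume (Set.univ : Set (EuclideanSpace ℝ (Fin k))) = ⊤ :=
    measure_univ_of_isAddLeftInvariant _
  have hσmeas : Measurable fun q : EuclideanSpace ℝ (Fin (n - k)) × EuclideanSpace ℝ (Fin k) =>
      σ q.1 q.2 := by
    simp only [hσ]
    exact measurable_lexRank_uncurry hFmeas measurable_norm
  have hlt : ∀ z t, volume {y | σ z y < t} = ENNReal.ofReal t := by
    intro z t
    rw [hσ]
    exact measure_lexRank_lt (hFz z) measurable_norm (hF0 z) norm_nonneg (hfin z) huniv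
      (volume_norm_eq_const hk) t
  have hadm : rearrangedKernel hkn.le s σ ∈ admissibleKernels n k s :=
    rearrangedKernel_mem_admissibleKernels hk hkn.le hs hσ0 hσmeas hlt
  refine ⟨σ, hσ0, fun z => ?_, hσmeas, hadm, fun K hK =>
    lintegral_rearrangedKernel_le hkn hs hw hw0 hσ0 (fun z y y' h => ?_) hadm hK⟩
  · have hm : Measurable (σ z) := hσmeas.comp measurable_prodMk_left
    rw [hσ] at hm ⊢
    exact measurePreserving_lexRank (hFz z) measurable_norm (hF0 z) norm_nonneg (hfin z)
      huniv (volume_norm_eq_const hk) hm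
  · rw [hσ] at h
    rw [← hF, ← hF]
    exact le_of_lexRank_lt (hfin z) h

end Optimality

theorem theorem4p1 (n k : ℕ) (hk : 1 ≤ k) (hkn : k < n) (s : ℝ) (hs : 1 / 2 < s) (hs' : s < 1)
    (u : EuclideanSpace ℝ (Fin n) → ℝ) (x₀ : EuclideanSpace ℝ (Fin n))
    (hu : Continuous u) (hu11 : IsC11At u x₀)
    (hP1 : Integrable (fun x => |u x| / (1 + ‖x‖) ^ ((n : ℝ) + 2 * s)) volume)
    (hP2 : ∀ x, 0 ≤ linearizedIncrement u x₀ x)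
    (hlevel : ∀ (t : ℝ), 0 < t → ∀ z : EuclideanSpace ℝ (Fin (n - k)),
      volume {y : EuclideanSpace ℝ (Fin k) | linearizedIncrement u x₀ (joinPoint y z) ≤ t} < ⊤) :
    ∃ σ : EuclideanSpace ℝ (Fin (n - k)) → EuclideanSpace ℝ (Fin k) → ℝ,
      (∀ z y, 0 ≤ σ z y) ∧
      (∀ z, MeasurePreserving (σ z) volume (volume.restrict (Set.Ici (0 : ℝ)))) ∧
      Measurable (fun q : EuclideanSpace ℝ (Fin (n - k)) × EuclideanSpace ℝ (Fin k) =>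
        σ q.1 q.2) ∧
      nonlocalF k s u x₀ < ⊤ ∧
      nonlocalF k s u x₀ = ENNReal.ofReal (fracLaplacianConst n s) *
        ∫⁻ z : EuclideanSpace ℝ (Fin (n - k)), ∫⁻ y : EuclideanSpace ℝ (Fin k),
          ENNReal.ofReal (linearizedIncrement u x₀ (joinPoint y z) /
            (((unitBallVolume k)⁻¹ * σ z y) ^ (2 / (k : ℝ)) + ‖z‖ ^ 2) ^
              (((n : ℝ) + 2 * s) / 2)) ∧
      ∃ K ∈ admissibleKernels n k s,
        (∀ (y : EuclideanSpace ℝ (Fin k)) (z : EuclideanSpace ℝ (Fin (n - k))),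
          K (joinPoint y z) =
            1 / (((unitBallVolume k)⁻¹ * σ z y) ^ (2 / (k : ℝ)) + ‖z‖ ^ 2) ^
              (((n : ℝ) + 2 * s) / 2)) ∧
        kernelOperator K u x₀ = ⨅ K' ∈ admissibleKernels n k s, kernelOperator K' u x₀ := by
  have hs0 : 0 < s := by linarith
  have hw := measurable_linearizedIncrement (x₀ := x₀) hu
  obtain ⟨σ, hσ0, hσ, hσmeas, hadm, hopt⟩ :=
    exists_optimal_rearrangement hk hkn hs0 hw hP2 hlevel
  have hmin : kernelOperator (rearrangedKernel hkn.le s σ) u x₀ =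
      ⨅ K' ∈ admissibleKernels n k s, kernelOperator K' u x₀ :=
    le_antisymm (le_iInf₂ hopt) (iInf₂_le _ hadm)
  refine ⟨σ, hσ0, hσ, hσmeas, ?_, ?_, rearrangedKernel hkn.le s σ, hadm,
    rearrangedKernel_joinPoint hkn.le s σ, hmin⟩
  -- The radial kernel serves as competitor in the infimum.
  · refine ENNReal.mul_lt_top ENNReal.ofReal_lt_top
      ((iInf₂_le _ (norm_rpow_mem_admissibleKernels hk hkn.le hs0)).trans_lt ?_)
    exact (integrable_linearizedIncrement_div_norm_rpow (by omega) hs hs' hu hu11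
      hP1).lintegral_lt_top
  · have hmeas : Measurable fun x =>
        ENNReal.ofReal (linearizedIncrement u x₀ x * rearrangedKernel hkn.le s σ x) :=
      (hw.mul hadm.1).ennreal_ofReal
    rw [nonlocalF, ← hmin, kernelOperator, lintegral_eq_lintegral_joinPoint hkn.le hmeas]
    simp only [rearrangedKernel_joinPoint, kernelProfile, mul_one_div]
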